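/- Let $G=\langle A\mid R\rangle$ be a group given by a finite presentation in which every relator $w\in R$, as an element of the free group on $A$, has word length at most $M$, where $M$ is a natural number. Let $X$ be the Cayley graph of $G$ with respect to $A$ (vertex set $G$, with $g\neq h$ adjacent if and only if $h=ga$ or $g=ha$ for some $a\in A$), and suppose that $G$ is one-ended, i.e. $X$ has exactly one end. For real $r\ge 0$ let $B_r$ be the full subgraph of $X$ spanned by the vertices at distance at most $r$ from the identity. For a finite graph $\Gamma$, a cut set is a set $S$ of vertices such that no connected component of $\Gamma-S$ has more than $|\Gamma|/2$ vertices, where $|\Gamma|$ is the number of vertices of $\Gamma$, and the cut size $\operatorname{cut}(\Gamma)$ is the minimal cardinality of a cut set of $\Gamma$. Then, for every real $r\ge 0$, $$\operatorname{cut}(B_r)\ \ge\ \frac{r}{400M}.$$ (A one-ended group as above necessarily has $M>0$.) -/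

import Mathlib

namespace CutBall

section Graphs

variable {V : Type*}

/-- `S` is a cut set of the finite graph `Γ`: no connected component of `Γ - S` has more than
half of the vertices of `Γ`. -/
def IsCutSet [Finite V] (Γ : SimpleGraph V) (S : Set V) : Prop :=
  ∀ C : (Γ.induce Sᶜ).ConnectedComponent, 2 * C.supp.ncard ≤ Nat.card V

/-- The cut size of a finite graph: the minimal cardinality of a cut set
(the whole vertex set is always a cut set, see `isCutSet_univ`). -/
noncomputable def cutSize [Finite V] (Γ : SimpleGraph V) : ℕ :=
  sInf {n : ℕ | ∃ S : Set V, IsCutSet Γ S ∧ S.ncard = n}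

theorem isCutSet_univ [Finite V] (Γ : SimpleGraph V) : IsCutSet Γ Set.univ := by
  intro C
  induction C using SimpleGraph.ConnectedComponent.ind with
  | h v => exact absurd (Set.mem_univ v.1) v.2

/-- The set of vertices of the closed ball of radius `r` about `c`, for the path metric of `X`
(points in other components are at infinite distance). -/
def closedBall (X : SimpleGraph V) (c : V) (r : ℝ) : Set V :=
  {v | X.Reachable c v ∧ (X.dist c v : ℝ) ≤ r}

/-- A graph is one-ended if it has exactly one end. -/
def IsOneEnded (X : SimpleGraph V) : Prop :=
  ∃! e, e ∈ X.end

end Graphs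

section Cayley

variable {α : Type*}

/-- The Cayley graph of the group `⟨α | rels⟩` with respect to the generators `α`:
`g` and `h` are adjacent iff `g ≠ h` and `h = g * a` or `g = h * a` for some generator `a`. -/
def cayleyGraph (rels : Set (FreeGroup α)) : SimpleGraph (PresentedGroup rels) :=
  SimpleGraph.mulCayley (Set.range (PresentedGroup.of (rels := rels)))

theorem finite_walk_ball [Finite α] (rels : Set (FreeGroup α)) (c : PresentedGroup rels) (n : ℕ) :
    {v | ∃ p : (cayleyGraph rels).Walk v c, p.length ≤ n}.Finite := by
  induction n with
  | zero =>
    refine (Set.finite_singleton c).subset ?_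
    rintro v ⟨p, hp⟩
    exact SimpleGraph.Walk.eq_of_length_eq_zero (Nat.le_zero.mp hp)
  | succ n ih =>
    have hA : (Set.range (PresentedGroup.of (rels := rels))).Finite := Set.finite_range _
    refine ((Set.finite_singleton c).union
      ((Set.Finite.image2 (fun v a => v * a⁻¹) ih hA).union
        (Set.Finite.image2 (fun v a => v * a) ih hA))).subset ?_
    rintro v ⟨p, hp⟩
    cases p with
    | nil => exact Or.inl rfl
    | @cons _ w _ h q =>
      right
      have hq : q.length ≤ n := by simpa using hp
      rw [cayleyGraph, SimpleGraph.mulCayley_adj'] at h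
      obtain ⟨-, a, ha, h | h⟩ := h
      · exact Or.inl ⟨w, ⟨q, hq⟩, a, ha, by simp [← h]⟩
      · exact Or.inr ⟨w, ⟨q, hq⟩, a, ha, h.symm⟩

instance finite_closedBall [Finite α] (rels : Set (FreeGroup α)) (c : PresentedGroup rels)
    (r : ℝ) : Finite (closedBall (cayleyGraph rels) c r) := by
  refine Set.Finite.to_subtype ((finite_walk_ball rels c ⌊r⌋₊).subset ?_)
  rintro v ⟨hv, hr⟩
  obtain ⟨p, hp⟩ := hv.exists_walk_length_eq_dist
  exact ⟨p.reverse, by rw [SimpleGraph.Walk.length_reverse, hp]; exact Nat.le_floor hr⟩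

end Cayley

end CutBall

/-!
Let `X` be the Cayley graph and suppose that the ball `B_r` has a cut set `S` with `n` points,
where `400 * M * n < r`. Decompose `S` into clusters, the classes of the relation generated by
`d(s, t) ≤ 2 * M`; a cluster with `k` points has diameter less than `2 * M * k`. Since `X` is
one-ended, the complement of a cluster `C` has one infinite component `U`, and the rest of the
complement is within the diameter of `C` from `C`: a long geodesic centred at a point of a bounded
component hits `C` on both sides (`CutBall.exists_dist_add_dist_le`).

Relators have length at most `M`, so any two points of `U` adjacent to `C` are joined by a path
outside of `C` and at distance at most `2 * M` from it (`CutBall.joinedIn_thickening_diff`). Such a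
path avoids all of `S`. The topological input is that a function on the edges with values in `ℤ/2`
which is a coboundary on every ball of radius `M` is a coboundary
(`CutBall.isCoarselySimplyConnected_cayleyGraph`).

Call a point of `B_r` bad if it is within `4 * M * k` of the base point of a cluster with `k` points.
For a good point `x`, a geodesic from `1` to `x` only meets clusters whose `2 * M`-neighbourhood lies
in `B_r`: beyond a cluster near the boundary there is only room for bad points. So the path from a
good point to another one through `1` can be rerouted around these clusters, one at a time, and all
good points lie in one component of `B_r - S`. Finally, balls can be packed disjointly along a
geodesic, so the number of bad points is less than half of the size of a ball of radius
`10 * M * n ≤ r` (`CutBall.IsHomogeneous.two_mul_sum_ncard_natBall_lt`), and the component of the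
good points has more than half of the points of `B_r`. This contradicts the choice of `S`.
-/

namespace CutBall

open Relation

/-! ### Paths, geodesics and the growth of balls -/

section Paths

variable {V : Type*} {X : SimpleGraph V} {S T : Set V} {x y z : V}

/-- `x` and `y` are joined by an edge path of `X` all of whose vertices lie in `T`
(the constant path at `x` is allowed even if `x ∉ T`). -/
def JoinedIn (X : SimpleGraph V) (T : Set V) : V → V → Prop :=
  ReflTransGen fun a b => X.Adj a b ∧ a ∈ T ∧ b ∈ T

namespace JoinedIn

theorem refl (X : SimpleGraph V) (T : Set V) (x : V) : JoinedIn X T x x := ReflTransGen.refl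

theorem trans (h : JoinedIn X T x y) (h' : JoinedIn X T y z) : JoinedIn X T x z :=
  ReflTransGen.trans h h'

theorem of_adj (h : X.Adj x y) (hx : x ∈ T) (hy : y ∈ T) : JoinedIn X T x y :=
  ReflTransGen.single ⟨h, hx, hy⟩

theorem symm (h : JoinedIn X T x y) : JoinedIn X T y x := by
  induction h with
  | refl => exact refl _ _ _
  | tail _ h ih => exact (of_adj h.1.symm h.2.2 h.2.1).trans ih

theorem mono (hST : S ⊆ T) (h : JoinedIn X S x y) : JoinedIn X T x y := by
  induction h with
  | refl => exact refl _ _ _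
  | tail _ h ih => exact ih.trans (of_adj h.1 (hST h.2.1) (hST h.2.2))

theorem mem (h : JoinedIn X T x y) (hx : x ∈ T) : y ∈ T := by
  induction h with
  | refl => exact hx
  | tail _ h _ => exact h.2.2

/-- A function that does not change along the edges inside `T` takes the same value at the two
ends of a path in `T`. -/
theorem map_eq {β : Type*} (h : JoinedIn X T x y) (F : V → β)
    (hF : ∀ a ∈ T, ∀ b ∈ T, X.Adj a b → F a = F b) : F x = F y := by
  induction h with
  | refl => rfl
  | tail _ h ih => exact ih.trans (hF _ h.2.1 _ h.2.2 h.1)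

theorem reachable_induce (h : JoinedIn X T x y) (hx : x ∈ T) (hy : y ∈ T) :
    (X.induce T).Reachable ⟨x, hx⟩ ⟨y, hy⟩ := by
  induction h with
  | refl => exact SimpleGraph.Reachable.refl _
  | tail _ h ih =>
    refine (ih h.2.1).trans (SimpleGraph.Adj.reachable ?_)
    exact h.1

theorem of_reachable_induce {x y : T} (h : (X.induce T).Reachable x y) : JoinedIn X T x y := by
  rw [SimpleGraph.reachable_iff_reflTransGen] at h
  induction h with
  | refl => exact refl _ _ _
  | @tail b c _ h ih => exact ih.trans (of_adj h b.2 c.2)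

end JoinedIn

/-- A vertex at distance `n + 1` from `x` has a neighbour at distance `n` from `x`. -/
theorem exists_adj_dist_eq (hX : X.Connected) {n : ℕ} (h : X.dist x y = n + 1) :
    ∃ z, X.Adj z y ∧ X.dist x z = n := by
  obtain ⟨p, hp⟩ := hX.exists_walk_length_eq_dist y x
  rw [X.dist_comm, h] at hp
  cases p with
  | nil => simp at hp
  | @cons _ z _ hyz q =>
    refine ⟨z, hyz.symm, le_antisymm ?_ ?_⟩
    · rw [X.dist_comm]
      exact (SimpleGraph.dist_le q).trans (by simpa using hp.le)
    · have h1 := hX.dist_triangle (u := x) (v := z) (w := y)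
      rw [SimpleGraph.dist_eq_one_iff_adj.2 hyz.symm] at h1
      omega

/-- Geodesics: any two vertices are joined by a path whose vertices `z` all satisfy the equality
`d(x, z) + d(z, y) = d(x, y)`. -/
theorem joinedIn_geodesic (hX : X.Connected) (x y : V) :
    JoinedIn X {z | X.dist x z + X.dist z y = X.dist x y} x y := by
  induction hn : X.dist x y generalizing y with
  | zero => rw [(hX.dist_eq_zero_iff).1 hn]; exact JoinedIn.refl _ _ _
  | succ n ih =>
    obtain ⟨z, hzy, hz⟩ := exists_adj_dist_eq hX hn
    have hd := SimpleGraph.dist_eq_one_iff_adj.2 hzy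
    refine ((ih z hz).mono fun w hw => ?_).trans (JoinedIn.of_adj hzy ?_ ?_)
    · have h1 := hX.dist_triangle (u := w) (v := z) (w := y)
      have h2 := hX.dist_triangle (u := x) (v := w) (w := y)
      simp only [Set.mem_ofPred_eq] at hw ⊢
      omega
    · simp only [Set.mem_ofPred_eq]; omega
    · simp [hn]

theorem exists_dist_eq_of_le (hX : X.Connected) {n : ℕ} (h : n ≤ X.dist x y) :
    ∃ z, X.dist x z = n ∧ X.dist x z + X.dist z y = X.dist x y := by
  obtain ⟨k, hk⟩ := Nat.exists_eq_add_of_le h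
  induction k generalizing y with
  | zero => exact ⟨y, by simpa using hk, by simp⟩
  | succ k ih =>
    obtain ⟨w, hwy, hw⟩ := exists_adj_dist_eq hX (n := n + k) (by omega)
    obtain ⟨z, hz, hz'⟩ := ih (by omega) hw
    have hd := SimpleGraph.dist_eq_one_iff_adj.2 hwy
    have h1 := hX.dist_triangle (u := z) (v := w) (w := y)
    have h2 := hX.dist_triangle (u := x) (v := z) (w := y)
    exact ⟨z, hz, by omega⟩

end Paths

section Growth

variable {V : Type*} {X : SimpleGraph V}

/-- The vertices at distance at most `n` from `x`, for connected graphs. -/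
def natBall (X : SimpleGraph V) (x : V) (n : ℕ) : Set V := {v | X.dist x v ≤ n}

/-- A connected, infinite, vertex-transitive graph with finite balls, such as the Cayley graph of
an infinite finitely generated group. -/
structure IsHomogeneous (X : SimpleGraph V) : Prop where
  connected : X.Connected
  infinite : Infinite V
  finite_natBall : ∀ x n, (natBall X x n).Finite
  exists_isometry : ∀ x y, ∃ e : V ≃ V, (∀ a b, X.dist (e a) (e b) = X.dist a b) ∧ e x = y

namespace IsHomogeneous

theorem ncard_natBall_eq (hX : IsHomogeneous X) (x y : V) (n : ℕ) :
    (natBall X x n).ncard = (natBall X y n).ncard := by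
  obtain ⟨e, he, rfl⟩ := hX.exists_isometry x y
  rw [← Set.ncard_image_of_injective _ e.injective]
  congr 1
  ext v
  obtain ⟨w, rfl⟩ := e.surjective v
  simp [natBall, he]

theorem exists_dist_eq (hX : IsHomogeneous X) (x : V) (n : ℕ) : ∃ y, X.dist x y = n := by
  have := hX.infinite
  obtain ⟨y, hy⟩ := (hX.finite_natBall x n).exists_notMem
  obtain ⟨z, hz, -⟩ := exists_dist_eq_of_le hX.connected (le_of_not_ge hy)
  exact ⟨z, hz⟩

/-- Every vertex is the midpoint of a geodesic of length `2 * n`. -/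
theorem exists_geodesic_through (hX : IsHomogeneous X) (x : V) (n : ℕ) :
    ∃ p q, X.dist x p = n ∧ X.dist x q = n ∧ X.dist p q = 2 * n := by
  obtain ⟨q, hq⟩ := hX.exists_dist_eq x (2 * n)
  obtain ⟨m, hm, hm'⟩ := exists_dist_eq_of_le hX.connected (x := x) (y := q) (n := n) (by omega)
  obtain ⟨e, he, rfl⟩ := hX.exists_isometry m x
  exact ⟨e (e m), e q, by rw [he, X.dist_comm]; exact hm, by rw [he]; omega, by rw [he]; exact hq⟩

theorem ncard_natBall_mono (hX : IsHomogeneous X) (x : V) {m n : ℕ} (h : m ≤ n) :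
    (natBall X x m).ncard ≤ (natBall X x n).ncard :=
  Set.ncard_le_ncard (fun _ hv => le_trans hv h) (hX.finite_natBall x n)

/-- Two disjoint balls of radii `a` and `b`, centred on a geodesic at distance `a + b + 1`, fit into
a ball of radius `a + b + 1`. -/
theorem ncard_natBall_add_le (hX : IsHomogeneous X) (x : V) (a b : ℕ) :
    (natBall X x a).ncard + (natBall X x b).ncard ≤ (natBall X x (a + b + 1)).ncard := by
  obtain ⟨q, hq⟩ := hX.exists_dist_eq x (a + b + 1)
  obtain ⟨m, hm, hm'⟩ :=
    exists_dist_eq_of_le hX.connected (x := x) (y := q) (n := b + 1) (by omega)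
  rw [hX.ncard_natBall_eq x q b, hX.ncard_natBall_eq x m (a + b + 1),
    ← Set.ncard_union_eq _ (hX.finite_natBall _ _) (hX.finite_natBall _ _)]
  · refine Set.ncard_le_ncard ?_ (hX.finite_natBall _ _)
    rintro v (hv | hv)
    · have := hX.connected.dist_triangle (u := m) (v := x) (w := v)
      rw [X.dist_comm] at hm
      simp only [natBall, Set.mem_ofPred_eq] at hv ⊢
      omega
    · have := hX.connected.dist_triangle (u := m) (v := q) (w := v)
      simp only [natBall, Set.mem_ofPred_eq] at hv ⊢
      omega
  · rw [Set.disjoint_left]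
    intro v hv hv'
    have := hX.connected.dist_triangle (u := x) (v := v) (w := q)
    rw [X.dist_comm (u := v) (v := q)] at this
    simp only [natBall, Set.mem_ofPred_eq] at hv hv'
    omega

/-- Disjoint balls of radii `ρ i`, two of each, fit strictly into a ball of radius
`∑ i, 2 * (ρ i + 1)`. -/
theorem two_mul_sum_ncard_natBall_lt (hX : IsHomogeneous X) (x : V) {ι : Type*} (s : Finset ι)
    (ρ : ι → ℕ) :
    2 * ∑ i ∈ s, (natBall X x (ρ i)).ncard < (natBall X x (∑ i ∈ s, 2 * (ρ i + 1))).ncard := by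
  classical
  induction s using Finset.induction_on with
  | empty =>
    simp only [Finset.sum_empty, mul_zero]
    exact (Set.ncard_pos (hX.finite_natBall _ _)).2 ⟨x, by simp [natBall]⟩
  | insert i s hi ih =>
    rw [Finset.sum_insert hi, Finset.sum_insert hi]
    have h1 := hX.ncard_natBall_add_le x (ρ i) (∑ i ∈ s, 2 * (ρ i + 1))
    have h2 := hX.ncard_natBall_add_le x (ρ i) (ρ i + (∑ i ∈ s, 2 * (ρ i + 1)) + 1)
    rw [show ρ i + (ρ i + (∑ i ∈ s, 2 * (ρ i + 1)) + 1) + 1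
      = 2 * (ρ i + 1) + ∑ i ∈ s, 2 * (ρ i + 1) by ring] at h2
    omega

end IsHomogeneous

end Growth

/-! ### Coarse simple connectivity of Cayley graphs -/

section CoarseSimpleConnectivity

/-- A homological form of coarse simple connectivity at scale `M`: a function on the edges of `X`
with values in `ℤ/2` which is a coboundary on every ball of radius `M` is a coboundary. -/
def IsCoarselySimplyConnected {V : Type*} (X : SimpleGraph V) (M : ℕ) : Prop :=
  ∀ f : V → V → ZMod 2, (∀ x, f x x = 0) → (∀ x y, f x y = f y x) →
    (∀ g, ∃ p : V → ZMod 2, ∀ x ∈ natBall X g M, ∀ y ∈ natBall X g M,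
      X.Adj x y → f x y = p x + p y) →
    ∃ F : V → ZMod 2, ∀ x y, X.Adj x y → f x y = F x + F y

variable {α : Type*} {rels : Set (FreeGroup α)}

theorem cayleyGraph_adj_mul_of {g : PresentedGroup rels} {a : α}
    (h : g ≠ g * PresentedGroup.of a) : (cayleyGraph rels).Adj g (g * PresentedGroup.of a) := by
  rw [cayleyGraph, SimpleGraph.mulCayley_adj']
  exact ⟨h, _, ⟨a, rfl⟩, Or.inl rfl⟩

theorem exists_of_cayleyGraph_adj {g h : PresentedGroup rels} (hgh : (cayleyGraph rels).Adj g h) :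
    ∃ a, h = g * PresentedGroup.of a ∨ g = h * PresentedGroup.of a := by
  rw [cayleyGraph, SimpleGraph.mulCayley_adj'] at hgh
  obtain ⟨-, _, ⟨a, rfl⟩, h | h⟩ := hgh
  · exact ⟨a, Or.inl h.symm⟩
  · exact ⟨a, Or.inr h⟩

theorem cayleyGraph_reachable_mul_of (g : PresentedGroup rels) (a : α) :
    (cayleyGraph rels).Reachable g (g * PresentedGroup.of a) := by
  by_cases h : g = g * PresentedGroup.of a
  · rw [← h]
  · exact (cayleyGraph_adj_mul_of h).reachable

theorem cayleyGraph_connected (rels : Set (FreeGroup α)) : (cayleyGraph rels).Connected := by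
  have key : ∀ (w : FreeGroup α) (g : PresentedGroup rels),
      (cayleyGraph rels).Reachable g (g * PresentedGroup.mk rels w) := by
    intro w
    induction w using FreeGroup.induction_on with
    | C1 => simp
    | of a => exact fun g => cayleyGraph_reachable_mul_of g a
    | inv_of a _ =>
      intro g
      have := cayleyGraph_reachable_mul_of (g * (PresentedGroup.mk rels (FreeGroup.of a))⁻¹) a
      rw [map_inv]
      rw [show (PresentedGroup.of a : PresentedGroup rels) =
        PresentedGroup.mk rels (FreeGroup.of a) from rfl, inv_mul_cancel_right] at this
      exact this.symm
    | mul x y hx hy =>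
      intro g
      rw [map_mul, ← mul_assoc]
      exact (hx g).trans (hy _)
  have : Nonempty (PresentedGroup rels) := ⟨1⟩
  refine SimpleGraph.Connected.mk fun g h => ?_
  obtain ⟨w, hw⟩ := PresentedGroup.mk_surjective rels (g⁻¹ * h)
  simpa [hw] using key w g

theorem cayleyGraph_dist_mul_of_le (g : PresentedGroup rels) (a : α) :
    (cayleyGraph rels).dist g (g * PresentedGroup.of a) ≤ 1 := by
  by_cases h : g = g * PresentedGroup.of a
  · rw [← h]; simp
  · exact (SimpleGraph.dist_eq_one_iff_adj.2 (cayleyGraph_adj_mul_of h)).le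

theorem cayleyGraph_dist_mul_left (g x y : PresentedGroup rels) :
    (cayleyGraph rels).dist (g * x) (g * y) = (cayleyGraph rels).dist x y := by
  have key : ∀ g x y : PresentedGroup rels,
      (cayleyGraph rels).dist (g * x) (g * y) ≤ (cayleyGraph rels).dist x y := by
    intro g x y
    obtain ⟨p, hp⟩ := (cayleyGraph_connected rels).exists_walk_length_eq_dist x y
    let φ : cayleyGraph rels →g cayleyGraph rels :=
      ⟨fun x => g * x, fun h => by
        rw [cayleyGraph] at h ⊢; exact SimpleGraph.mulCayley_adj_mul_iff_right.2 h⟩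
    rw [← hp, ← p.length_map φ]
    exact SimpleGraph.dist_le (p.map φ)
  refine le_antisymm (key g x y) ?_
  simpa using key g⁻¹ (g * x) (g * y)

theorem isHomogeneous_cayleyGraph [Finite α] (rels : Set (FreeGroup α))
    [Infinite (PresentedGroup rels)] : IsHomogeneous (cayleyGraph rels) where
  connected := cayleyGraph_connected rels
  infinite := inferInstance
  finite_natBall x n := by
    refine (finite_walk_ball rels x n).subset fun v hv => ?_
    obtain ⟨p, hp⟩ := (cayleyGraph_connected rels).exists_walk_length_eq_dist v x
    exact ⟨p, by rw [hp, SimpleGraph.dist_comm]; exact hv⟩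
  exists_isometry x y :=
    ⟨Equiv.mulLeft (y * x⁻¹), fun a b => cayleyGraph_dist_mul_left _ a b, by simp⟩

/-- The permutation of `G × ℤ/2` induced by a generator `a` and a function `f` on pairs of vertices:
it moves the first coordinate along the edge labelled `a` and adds the value of `f` on that edge to
the second coordinate. -/
def edgePerm (f : PresentedGroup rels → PresentedGroup rels → ZMod 2) (a : α) :
    Equiv.Perm (PresentedGroup rels × ZMod 2) where
  toFun q := (q.1 * PresentedGroup.of a, q.2 + f q.1 (q.1 * PresentedGroup.of a))
  invFun q := (q.1 * (PresentedGroup.of a)⁻¹, q.2 - f (q.1 * (PresentedGroup.of a)⁻¹) q.1)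
  left_inv q := by simp
  right_inv q := by simp

/-- Reading a word `L` of length at most `n` from a vertex `x` with `d(g, x) + n ≤ M` does not leave
the ball of radius `M` about `g`, so if `f` is the coboundary of `p` on this ball, the values of `f`
along the word telescope. -/
theorem lift_edgePerm_apply {f : PresentedGroup rels → PresentedGroup rels → ZMod 2} {M : ℕ}
    {g : PresentedGroup rels} {p : PresentedGroup rels → ZMod 2}
    (hf0 : ∀ x, f x x = 0)
    (hp : ∀ x ∈ natBall (cayleyGraph rels) g M, ∀ y ∈ natBall (cayleyGraph rels) g M,
      (cayleyGraph rels).Adj x y → f x y = p x + p y)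
    (L : List (α × Bool)) (x : PresentedGroup rels) (t : ZMod 2)
    (hL : (cayleyGraph rels).dist g x + L.length ≤ M) :
    (FreeGroup.lift (fun a => (edgePerm f a)⁻¹) (FreeGroup.mk L))⁻¹ (x, t) =
      (x * PresentedGroup.mk rels (FreeGroup.mk L),
        t + p x + p (x * PresentedGroup.mk rels (FreeGroup.mk L))) := by
  have hconn := cayleyGraph_connected rels
  have edge : ∀ x (a : α), x ∈ natBall (cayleyGraph rels) g M →
      x * PresentedGroup.of a ∈ natBall (cayleyGraph rels) g M →
      f x (x * PresentedGroup.of a) = p x + p (x * PresentedGroup.of a) := by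
    intro x a hx hy
    by_cases h : x = x * PresentedGroup.of a
    · rw [← h, hf0, CharTwo.add_self_eq_zero]
    · exact hp _ hx _ hy (cayleyGraph_adj_mul_of h)
  induction L generalizing x t with
  | nil =>
    simp [← FreeGroup.one_eq_mk, add_assoc, CharTwo.add_self_eq_zero]
  | cons s L ih =>
    obtain ⟨a, b⟩ := s
    simp only [List.length_cons] at hL
    have hx : x ∈ natBall (cayleyGraph rels) g M := by simp only [natBall, Set.mem_ofPred_eq]; omega
    have hcons : FreeGroup.mk ((a, b) :: L) = FreeGroup.mk [(a, b)] * FreeGroup.mk L := by simp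
    rw [hcons, map_mul, mul_inv_rev, Equiv.Perm.mul_apply, map_mul, ← mul_assoc]
    have tri := fun y => hconn.dist_triangle (u := g) (v := x) (w := y)
    cases b with
    | true =>
      have h1 := cayleyGraph_dist_mul_of_le x a
      have h2 := tri (x * PresentedGroup.of a)
      have hy : x * PresentedGroup.of a ∈ natBall (cayleyGraph rels) g M := by
        simp only [natBall, Set.mem_ofPred_eq]; omega
      have : (FreeGroup.lift (fun a => (edgePerm f a)⁻¹) (FreeGroup.mk [(a, true)]))⁻¹ (x, t) =
          (x * PresentedGroup.of a, t + f x (x * PresentedGroup.of a)) := by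
        simp [edgePerm]
      rw [this, show PresentedGroup.mk rels (FreeGroup.mk [(a, true)]) = PresentedGroup.of a from rfl,
        ih _ _ (by omega), edge x a hx hy]
      refine Prod.ext rfl ?_
      linear_combination CharTwo.add_self_eq_zero (p (x * PresentedGroup.of a))
    | false =>
      have hinv : PresentedGroup.mk rels (FreeGroup.mk [(a, false)]) =
          (PresentedGroup.of a : PresentedGroup rels)⁻¹ := by
        rw [PresentedGroup.of, ← map_inv]; rfl
      have h1 := cayleyGraph_dist_mul_of_le (x * (PresentedGroup.of a)⁻¹) a
      have h2 := tri (x * (PresentedGroup.of a)⁻¹)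
      rw [inv_mul_cancel_right, SimpleGraph.dist_comm] at h1
      have hy : x * (PresentedGroup.of a)⁻¹ ∈ natBall (cayleyGraph rels) g M := by
        simp only [natBall, Set.mem_ofPred_eq]; omega
      have : (FreeGroup.lift (fun a => (edgePerm f a)⁻¹) (FreeGroup.mk [(a, false)]))⁻¹ (x, t) =
          (x * (PresentedGroup.of a)⁻¹, t - f (x * (PresentedGroup.of a)⁻¹) x) := by
        simp [edgePerm]
      have he := edge (x * (PresentedGroup.of a)⁻¹) a hy (by simpa using hx)
      rw [inv_mul_cancel_right] at he
      rw [this, hinv, ih _ _ (by omega), he]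
      refine Prod.ext rfl ?_
      linear_combination - CharTwo.add_self_eq_zero (p x)

/-- The Cayley graph of a presentation with relators of length at most `M` is coarsely simply
connected at scale `M`. A function `f` as in the definition makes the free group act on `G × ℤ/2`;
the relators act trivially because `f` telescopes along them, so `G` acts, and the orbit map
of `(1, 0)` supplies the primitive of `f`. -/
theorem isCoarselySimplyConnected_cayleyGraph [DecidableEq α] {M : ℕ}
    (hM : ∀ w ∈ rels, w.norm ≤ M) : IsCoarselySimplyConnected (cayleyGraph rels) M := by
  intro f hf0 hsymm hloc
  have hrel : ∀ w ∈ rels, FreeGroup.lift (fun a => (edgePerm f a)⁻¹) w = 1 := by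
    intro w hw
    rw [← inv_eq_one]
    ext1 ⟨g, t⟩
    obtain ⟨p, hp⟩ := hloc g
    have := lift_edgePerm_apply hf0 hp w.toWord g t (by simpa [FreeGroup.norm] using hM w hw)
    rw [FreeGroup.mk_toWord, PresentedGroup.one_of_mem hw, mul_one, add_assoc,
      CharTwo.add_self_eq_zero, add_zero] at this
    simpa using this
  let φ := PresentedGroup.toGroup hrel
  have hstep : ∀ g a, (φ (g * PresentedGroup.of a))⁻¹ (1, 0) =
      edgePerm f a ((φ g)⁻¹ (1, 0)) := by
    intro g a
    rw [map_mul, mul_inv_rev, Equiv.Perm.mul_apply]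
    congr 1
  have hfst : ∀ g, ((φ g)⁻¹ (1, 0)).1 = g := by
    let H : Subgroup (PresentedGroup rels) :=
      { carrier := {h | ∀ q : PresentedGroup rels × ZMod 2, ((φ h)⁻¹ q).1 = q.1 * h}
        one_mem' := fun q => by rw [map_one, inv_one, Equiv.Perm.one_apply, mul_one]
        mul_mem' := by
          intro a b ha hb q
          rw [map_mul, mul_inv_rev, Equiv.Perm.mul_apply, hb, ha, mul_assoc]
        inv_mem' := by
          intro a ha q
          have := ha ((φ a) q)
          rw [← Equiv.Perm.mul_apply, inv_mul_cancel, Equiv.Perm.one_apply] at this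
          rw [map_inv, inv_inv, this, mul_inv_cancel_right] }
    intro g
    have hg : g ∈ H := PresentedGroup.generated_by rels H (fun a q => by simp [φ, edgePerm]) g
    simpa using hg (1, 0)
  have hgen : ∀ g a, f g (g * PresentedGroup.of a) =
      ((φ g)⁻¹ (1, 0)).2 + ((φ (g * PresentedGroup.of a))⁻¹ (1, 0)).2 := by
    intro g a
    rw [hstep]
    simp only [edgePerm, Equiv.coe_fn_mk, hfst]
    rw [← add_assoc, CharTwo.add_self_eq_zero, zero_add]
  refine ⟨fun g => ((φ g)⁻¹ (1, 0)).2, fun x y hxy => ?_⟩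
  obtain ⟨a, rfl | rfl⟩ := exists_of_cayleyGraph_adj hxy
  · exact hgen x a
  · rw [hsymm, add_comm]
    exact hgen y a

end CoarseSimpleConnectivity

/-! ### One-ended graphs -/

section OneEnded

open CategoryTheory Opposite

variable {V : Type*} {X : SimpleGraph V}

/-- A finite graph has no end: the component outside of the whole vertex set would be empty. -/
theorem IsOneEnded.infinite (h : IsOneEnded X) : Infinite V := by
  by_contra hV
  rw [not_infinite_iff_finite] at hV
  cases nonempty_fintype V
  obtain ⟨s, -, -⟩ := h
  obtain ⟨v, hv, -⟩ := (s (op Finset.univ)).nonempty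
  exact hv (by simp)

/-- Every infinite component of the complement of a finite set contains an end: by compactness,
it extends to a compatible family of infinite components. -/
theorem exists_end_apply_eq (hX : X.Connected) [X.LocallyFinite] [Infinite V] (K : Finset V)
    (C : X.ComponentCompl K) (hC : C.supp.Infinite) :
    ∃ e ∈ X.end, e (op K) = C := by
  have : Fact X.Preconnected := ⟨hX.preconnected⟩
  let F := X.componentComplFunctor
  have hfin : ∀ j, Finite (F.obj j) := fun j => SimpleGraph.componentCompl_finite j.unop
  have hne : ∀ j, Nonempty (F.obj j) := fun j => X.componentCompl_nonempty_of_infinite j.unop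
  have hML : F.IsMittagLeffler :=
    F.isMittagLeffler_of_exists_finite_range fun j => ⟨j, 𝟙 j, Set.toFinite _⟩
  have hne' : ∀ j, Nonempty (F.toEventualRanges.obj j) := F.toEventualRanges_nonempty hML
  have hmem : C ∈ F.eventualRange (op K) := (X.infinite_iff_in_eventualRange C).1 hC
  obtain ⟨s, hs⟩ := F.toEventualRanges.eval_section_surjective_of_surjective
    (F.surjective_toEventualRanges hML) (op K) ⟨C, hmem⟩
  refine ⟨_, (F.toEventualRangesSectionsEquiv s).2, ?_⟩
  exact congrArg Subtype.val hs

theorem IsOneEnded.joinedIn_compl (hX : X.Connected) [X.LocallyFinite] (h : IsOneEnded X)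
    (K : Finset V) {x y : V} (hx : x ∉ K) (hy : y ∉ K)
    (hxi : {w | JoinedIn X (K : Set V)ᶜ x w}.Infinite)
    (hyi : {w | JoinedIn X (K : Set V)ᶜ y w}.Infinite) :
    JoinedIn X (K : Set V)ᶜ x y := by
  have := h.infinite
  have key : ∀ z, ∀ hz : z ∉ (K : Set V), {w | JoinedIn X (K : Set V)ᶜ z w}.Infinite →
      ∃ e ∈ X.end, e (op K) = X.componentComplMk hz := by
    intro z hz hzi
    refine exists_end_apply_eq hX K _ (hzi.mono fun w hw => ?_)
    have hwK : w ∉ (K : Set V) := JoinedIn.mem hw hz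
    exact ⟨hwK, SimpleGraph.ConnectedComponent.eq.2 (JoinedIn.reachable_induce hw hz hwK).symm⟩
  obtain ⟨e, he, hex⟩ := key x (by simpa using hx) hxi
  obtain ⟨e', he', hey⟩ := key y (by simpa using hy) hyi
  have hee := h.unique he he'
  subst hee
  exact JoinedIn.of_reachable_induce (SimpleGraph.ConnectedComponent.eq.1 (hex.symm.trans hey))

end OneEnded

/-! ### Clusters and detours -/

section Clusters

variable {V : Type*} {X : SimpleGraph V} {C T : Set V} {D M : ℕ}

/-- The vertices at distance at most `D` from the set `C`, for connected graphs. -/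
def thickening (X : SimpleGraph V) (D : ℕ) (C : Set V) : Set V := {x | ∃ c ∈ C, X.dist c x ≤ D}

/-- Any two points of `C` are joined by a chain of points of `C` with jumps of length at most
`D`. -/
def IsChainConnected (X : SimpleGraph V) (D : ℕ) (C : Set V) : Prop :=
  ∀ a ∈ C, ∀ b ∈ C, ReflTransGen (fun x y => x ∈ C ∧ y ∈ C ∧ X.dist x y ≤ D) a b

/-- The union of the infinite components of the complement of `C`. -/
def outerPart (X : SimpleGraph V) (C : Set V) : Set V :=
  {x | x ∉ C ∧ {w | JoinedIn X Cᶜ x w}.Infinite}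

theorem outerPart_of_adj {x y : V} (hx : x ∈ outerPart X C) (hy : y ∉ C) (h : X.Adj x y) :
    y ∈ outerPart X C :=
  ⟨hy, hx.2.mono fun _ hw => (JoinedIn.of_adj h.symm hy hx.1).trans hw⟩

/-- A minimal chain visits each point of `C` at most once, so it has at most `C.ncard - 1` jumps. -/
theorem IsChainConnected.dist_add_le (hX : X.Connected) (hC : IsChainConnected X D C)
    (hfin : C.Finite) {a b : V} (ha : a ∈ C) (hb : b ∈ C) :
    X.dist a b + D ≤ C.ncard * D := by
  classical
  let N : SimpleGraph C := SimpleGraph.fromRel fun x y => X.dist (x : V) y ≤ D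
  have hN : ∀ x y : C, N.Adj x y → X.dist (x : V) y ≤ D := by
    intro x y h
    obtain ⟨-, h | h⟩ := (SimpleGraph.fromRel_adj _ _ _).1 h
    · exact h
    · rwa [SimpleGraph.dist_comm]
  have hlen : ∀ {x y : C} (p : N.Walk x y), X.dist (x : V) y ≤ p.length * D := by
    intro x y p
    induction p with
    | nil => simp
    | @cons x y z h p ih =>
      have := hX.dist_triangle (u := (x : V)) (v := y) (w := z)
      have := hN _ _ h
      rw [SimpleGraph.Walk.length_cons, add_mul]
      omega
  have hreach : ∀ {y : V} (hy : y ∈ C),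
      ReflTransGen (fun x y => x ∈ C ∧ y ∈ C ∧ X.dist x y ≤ D) a y →
      N.Reachable ⟨a, ha⟩ ⟨y, hy⟩ := by
    intro y hy h
    induction h with
    | refl => exact SimpleGraph.Reachable.refl _
    | @tail x y _ h ih =>
      refine (ih h.1).trans ?_
      by_cases hxy : x = y
      · subst hxy; exact SimpleGraph.Reachable.refl _
      · refine SimpleGraph.Adj.reachable ((SimpleGraph.fromRel_adj _ _ _).2 ⟨?_, Or.inl h.2.2⟩)
        simpa using hxy
  obtain ⟨p, hp⟩ := (hreach hb (hC a ha b hb)).exists_isPath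
  have := hfin.fintype
  have h1 := hp.length_lt
  rw [← Nat.card_eq_fintype_card, Nat.card_coe_set_eq] at h1
  calc X.dist a b + D ≤ p.length * D + D := Nat.add_le_add_right (hlen p) D
    _ = (p.length + 1) * D := by ring
    _ ≤ C.ncard * D := Nat.mul_le_mul_right D h1

/-- Let `u` and `v` be joined outside of `C` and adjacent to `C`. If they lay in different
components of `thickening (2 * M) C \ C`, then the edges between `C` and the component `W` of `u`
would define a function which locally is the coboundary of the indicator function of `W`. A global
primitive `F` of it is constant on `C` and satisfies `F u = F v`, so it changes by the same amount
along an edge from `u` to `C` and along an edge from `v` to `C`; but the function is `1` on the former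
and `0` on the latter. -/
theorem joinedIn_thickening_diff (hX : X.Connected) (hM : 1 ≤ M)
    (hsc : IsCoarselySimplyConnected X M) (hC : IsChainConnected X (2 * M) C) {u v c c' : V}
    (hc : c ∈ C) (hc' : c' ∈ C) (hu : u ∉ C) (hv : v ∉ C) (huc : X.Adj u c) (hvc : X.Adj v c')
    (huv : JoinedIn X Cᶜ u v) : JoinedIn X (thickening X (2 * M) C \ C) u v := by
  classical
  set N := thickening X (2 * M) C with hN
  have hadj : ∀ x ∉ C, ∀ c ∈ C, X.Adj x c → x ∈ N \ C := fun x hx c hc h =>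
    ⟨⟨c, hc, by rw [SimpleGraph.dist_eq_one_iff_adj.2 h.symm]; omega⟩, hx⟩
  have huN := hadj u hu c hc huc
  by_contra hcon
  set W : Set V := {w | JoinedIn X (N \ C) u w} with hW
  have hWN : ∀ w ∈ W, w ∈ N \ C := fun w hw => JoinedIn.mem hw huN
  have hWC : ∀ w ∈ W, w ∉ C := fun w hw => (hWN w hw).2
  have huW : u ∈ W := JoinedIn.refl _ _ _
  let ind : V → ZMod 2 := fun x => if x ∈ W then 1 else 0
  let f : V → V → ZMod 2 := fun x y => if (x ∈ C ∧ y ∈ W) ∨ (x ∈ W ∧ y ∈ C) then 1 else 0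
  have hloc : ∀ x ∈ N, ∀ y ∈ N, X.Adj x y → f x y = ind x + ind y := by
    intro x hx y hy hxy
    have hstep : ∀ x ∈ N, ∀ y ∈ N, X.Adj x y → x ∈ W → y ∉ C → y ∈ W := fun x _ y hy hxy hxW hyC =>
      JoinedIn.trans hxW (JoinedIn.of_adj hxy (hWN x hxW) ⟨hy, hyC⟩)
    have h1 := hstep x hx y hy hxy
    have h2 := hstep y hy x hx hxy.symm
    have h3 := hWC x
    have h4 := hWC y
    by_cases hxW : x ∈ W <;> by_cases hyW : y ∈ W <;> by_cases hxC : x ∈ C <;>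
      by_cases hyC : y ∈ C <;> simp_all [f, ind, CharTwo.add_self_eq_zero]
  obtain ⟨F, hF⟩ := hsc f
    (fun x => if_neg (by rintro (h | h); exacts [hWC x h.2 h.1, hWC x h.1 h.2]))
    (fun x y => by simp only [f]; congr 1; apply propext; tauto)
    (by
      intro g
      by_cases h : ∃ q ∈ natBall X g M, q ∈ C
      · -- A ball of radius `M` that meets `C` is contained in the thickening.
        obtain ⟨q, hq, hqC⟩ := h
        have hball : ∀ x ∈ natBall X g M, x ∈ N := by
          intro x hx
          have := hX.dist_triangle (u := q) (v := g) (w := x)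
          rw [X.dist_comm (u := q) (v := g)] at this
          simp only [natBall, Set.mem_ofPred_eq] at hq hx
          exact ⟨q, hqC, by omega⟩
        exact ⟨ind, fun x hx y hy => hloc x (hball x hx) y (hball y hy)⟩
      · push Not at h
        refine ⟨0, fun x hx y hy _ => ?_⟩
        simp only [Pi.zero_apply, add_zero]
        exact if_neg (by rintro (h' | h'); exacts [h x hx h'.1, h y hy h'.2]))
  have eq_of_add : ∀ {a b : ZMod 2}, a + b = 0 → a = b := fun {a b} h => by
    linear_combination h - CharTwo.add_self_eq_zero b
  have hFuv : F u = F v := huv.map_eq F fun a ha b hb hab => eq_of_add <| by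
    rw [← hF a b hab]
    exact if_neg (by rintro (h | h); exacts [ha h.1, hb h.2])
  have hjump : ∀ a ∈ C, ∀ b ∈ C, X.dist a b ≤ 2 * M → F a = F b := by
    intro a ha b hb hab
    have h : F a + ind a = F b + ind b :=
      (joinedIn_geodesic hX a b).map_eq (fun z => F z + ind z) fun z hz z' hz' hzz => by
        have hmem : ∀ z, z ∈ {z | X.dist a z + X.dist z b = X.dist a b} → z ∈ N := by
          intro z hz
          simp only [Set.mem_ofPred_eq] at hz
          exact ⟨a, ha, by omega⟩
        have h1 := hloc z (hmem z hz) z' (hmem z' hz') hzz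
        rw [hF z z' hzz] at h1
        linear_combination h1 - CharTwo.add_self_eq_zero (F z') + CharTwo.add_self_eq_zero (ind z)
    have ha' : ind a = 0 := if_neg fun h => hWC a h ha
    have hb' : ind b = 0 := if_neg fun h => hWC b h hb
    simpa [ha', hb'] using h
  have hFcc : F c = F c' := by
    have hch := hC c hc c' hc'
    clear hvc hc'
    induction hch with
    | refl => rfl
    | tail _ h ih => exact ih.trans (hjump _ h.1 _ h.2.1 h.2.2)
  have h1 : F u + F c = 1 := by
    rw [← hF u c huc]
    exact if_pos (Or.inr ⟨huW, hc⟩)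
  have h0 : F v + F c' = 0 := by
    rw [← hF v c' hvc]
    exact if_neg (by rintro (h | h); exacts [hv h.1, hcon h.1])
  rw [hFuv, hFcc, h0] at h1
  exact zero_ne_one h1

/-- The bounded components of the complement of `C` are not deeper than `C` is wide: a long geodesic
through a point `x` of such a component has to hit `C` on both sides of `x`. -/
theorem exists_dist_add_dist_le (hX : IsHomogeneous X) {x : V} (hxC : x ∉ C)
    (hx : x ∉ outerPart X C) :
    ∃ c ∈ C, ∃ c' ∈ C, X.dist x c + X.dist x c' ≤ X.dist c c' := by
  have hfin : {w | JoinedIn X Cᶜ x w}.Finite := by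
    by_contra h
    exact hx ⟨hxC, h⟩
  obtain ⟨n, hn⟩ := (hfin.image (X.dist x)).bddAbove
  obtain ⟨p, q, hp, hq, hpq⟩ := hX.exists_geodesic_through x (n + 1)
  have key : ∀ p, X.dist x p = n + 1 → ∃ c ∈ C, X.dist x c + X.dist c p = n + 1 := by
    intro p hp
    by_contra! h
    have hj : JoinedIn X Cᶜ x p := (joinedIn_geodesic hX.connected x p).mono fun z hz hzC =>
      h z hzC (hp ▸ hz)
    have := hn ⟨p, hj, rfl⟩
    omega
  obtain ⟨c, hc, hcp⟩ := key p hp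
  obtain ⟨c', hc', hcq⟩ := key q hq
  refine ⟨c, hc, c', hc', ?_⟩
  have h1 := hX.connected.dist_triangle (u := p) (v := c) (w := q)
  have h2 := hX.connected.dist_triangle (u := c) (v := c') (w := q)
  rw [X.dist_comm (u := p) (v := c)] at h1
  omega

/-- A path between two points of the outer part of `C` can be rerouted around `C` if any two
points where it may enter and leave `C` can be joined around `C`. -/
theorem JoinedIn.detour {x y : V} (h : JoinedIn X T x y) (hx : x ∈ outerPart X C)
    (hy : y ∈ outerPart X C)
    (hdet : ∀ u ∈ outerPart X C, ∀ v ∈ outerPart X C, (∃ c ∈ C, X.Adj u c) →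
      (∃ c ∈ C, X.Adj v c) → JoinedIn X (T \ C) u v) :
    JoinedIn X (T \ C) x y := by
  have key : (y ∈ outerPart X C → JoinedIn X (T \ C) x y) ∧
      (y ∉ outerPart X C → ∃ u ∈ outerPart X C, (∃ c ∈ C, X.Adj u c) ∧ JoinedIn X (T \ C) x u) := by
    clear hy
    induction h with
    | refl => exact ⟨fun _ => JoinedIn.refl _ _ _, fun h => absurd hx h⟩
    | @tail z w _ hzw ih =>
      obtain ⟨hadj, hzT, hwT⟩ := hzw
      by_cases hz : z ∈ outerPart X C
      · refine ⟨fun hw => (ih.1 hz).trans (.of_adj hadj ⟨hzT, hz.1⟩ ⟨hwT, hw.1⟩), fun hw => ?_⟩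
        have hwC : w ∈ C := by
          by_contra hwC
          exact hw (outerPart_of_adj hz hwC hadj)
        exact ⟨z, hz, ⟨w, hwC, hadj⟩, ih.1 hz⟩
      · obtain ⟨u, hu, huC, hxu⟩ := ih.2 hz
        refine ⟨fun hw => ?_, fun _ => ⟨u, hu, huC, hxu⟩⟩
        have hzC : z ∈ C := by
          by_contra hzC
          exact hz (outerPart_of_adj hw hzC hadj.symm)
        exact hxu.trans (hdet u hu w hw huC ⟨z, hzC, hadj.symm⟩)
  exact key.1 hy

open Classical in
/-- A finite set decomposes into clusters: each of them is chain connected with jumps of length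
at most `D`, and different clusters are at distance more than `D`. -/
theorem exists_clusters (X : SimpleGraph V) (D : ℕ) (S : Finset V) :
    ∃ P : Finpartition S, (∀ C ∈ P.parts, IsChainConnected X D (C : Set V)) ∧
      ∀ C ∈ P.parts, ∀ C' ∈ P.parts, C ≠ C' → ∀ c ∈ C, ∀ c' ∈ C', D < X.dist c c' := by
  let R : V → V → Prop := fun x y => x ∈ S ∧ y ∈ S ∧ X.dist x y ≤ D
  have hR : ∀ x y, R x y → R y x := fun x y h => ⟨h.2.1, h.1, by rw [X.dist_comm]; exact h.2.2⟩
  have hsymm : ∀ {x y}, ReflTransGen R x y → ReflTransGen R y x := by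
    intro x y h
    induction h with
    | refl => exact .refl
    | tail _ h ih => exact ReflTransGen.head (hR _ _ h) ih
  let s : Setoid V := ⟨ReflTransGen R, fun _ => .refl, hsymm, fun h h' => h.trans h'⟩
  let P := Finpartition.ofSetSetoid s S
  have hP : ∀ C ∈ P.parts, ∀ a ∈ C, ∀ b, b ∈ C ↔ b ∈ S ∧ ReflTransGen R a b := by
    intro C hC a ha b
    have h := Finpartition.mem_part_ofSetSetoid_iff_rel (s := s) S (a := a) (b := b)
    have haS : a ∈ S := P.le hC ha
    rw [show (Finpartition.ofSetSetoid s S).part a = C from P.part_eq_of_mem hC ha] at h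
    rw [h]
    exact ⟨fun h => h.2, fun h => ⟨haS, h⟩⟩
  refine ⟨P, fun C hC a ha b hb => ?_, fun C hC C' hC' hne c hc c' hc' => ?_⟩
  · have h := ((hP C hC a ha b).1 hb).2
    clear hb
    induction h with
    | refl => exact .refl
    | @tail x y hx h ih =>
      exact ih.tail ⟨(hP C hC a ha x).2 ⟨h.1, hx⟩, (hP C hC a ha y).2 ⟨h.2.1, hx.tail h⟩, h.2.2⟩
  · by_contra hle
    have hcS := P.le hC hc
    have hcS' := P.le hC' hc'
    have : c' ∈ C := (hP C hC c hc c').2 ⟨hcS', .single ⟨hcS, hcS', not_lt.1 hle⟩⟩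
    exact hne (P.eq_of_mem_parts hC hC' this hc')

end Clusters

/-! ### Separating balls -/

section Separation

variable {V : Type*} {X : SimpleGraph V} {M : ℕ}

/-- If `S` is small compared to `R`, then the points of the ball of radius `R` outside of an
exceptional set `B`, which contains less than half of the ball, are joined to each other in the ball
outside of `S`. The set `B` is a union of balls around the clusters of `S`, with radii proportional
to the sizes of the clusters. -/
theorem exists_small_joinedIn_diff (hX : IsHomogeneous X) (hM : 1 ≤ M)
    (hsc : IsCoarselySimplyConnected X M)
    (hend : ∀ C : Finset V, ∀ x ∈ outerPart X (C : Set V), ∀ y ∈ outerPart X (C : Set V),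
      JoinedIn X (C : Set V)ᶜ x y)
    (o : V) (R : ℕ) (S : Finset V) (hS : 10 * M * S.card ≤ R) :
    ∃ B : Set V, B.Finite ∧ 2 * B.ncard < (natBall X o R).ncard ∧ (S : Set V) ⊆ B ∧
      ∀ x ∈ natBall X o R \ B, ∀ y ∈ natBall X o R \ B, JoinedIn X (natBall X o R \ S) x y := by
  classical
  obtain ⟨P, hchain, hsep⟩ := exists_clusters X (2 * M) S
  have hcenter : ∀ C : Finset V, ∃ s, C ∈ P.parts → s ∈ C := by
    intro C
    by_cases h : C ∈ P.parts
    · obtain ⟨s, hs⟩ := P.nonempty_of_mem_parts h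
      exact ⟨s, fun _ => hs⟩
    · exact ⟨o, fun h' => absurd h' h⟩
  choose s hs using hcenter
  have tri := @hX.connected.dist_triangle
  have hdiam : ∀ C ∈ P.parts, ∀ a ∈ C, ∀ b ∈ C, X.dist a b + 2 * M ≤ C.card * (2 * M) := by
    intro C hC a ha b hb
    have := (hchain C hC).dist_add_le hX.connected C.finite_toSet ha hb
    rwa [Set.ncard_coe_finset] at this
  let B : Set V := ⋃ C ∈ P.parts, natBall X (s C) (4 * M * C.card)
  have hBfin : B.Finite := P.parts.finite_toSet.biUnion fun C _ => hX.finite_natBall _ _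
  have hB : ∀ {x}, x ∉ B → ∀ C ∈ P.parts, 4 * M * C.card < X.dist (s C) x := by
    intro x hx C hC
    by_contra h
    exact hx (Set.mem_biUnion hC (not_lt.1 h))
  refine ⟨B, hBfin, ?_, ?_, ?_⟩
  · have h1 : B.ncard ≤ ∑ C ∈ P.parts, (natBall X o (4 * M * C.card)).ncard := by
      refine (Finset.set_ncard_biUnion_le _ _).trans (Finset.sum_le_sum fun C _ => ?_)
      rw [hX.ncard_natBall_eq _ o]
    have h2 := hX.two_mul_sum_ncard_natBall_lt o P.parts fun C => 4 * M * C.card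
    have h3 : ∑ C ∈ P.parts, 2 * (4 * M * C.card + 1) ≤ R := by
      refine le_trans ?_ hS
      rw [← P.sum_card_parts, Finset.mul_sum]
      refine Finset.sum_le_sum fun C hC => ?_
      have : 1 ≤ C.card := (P.nonempty_of_mem_parts hC).card_pos
      nlinarith
    have h4 := hX.ncard_natBall_mono o h3
    omega
  · intro x hx
    obtain ⟨C, hC, hxC⟩ := P.exists_mem hx
    refine Set.mem_biUnion hC ?_
    have := hdiam C hC _ (hs C hC) x hxC
    simp only [natBall, Set.mem_ofPred_eq]
    nlinarith
  rintro x ⟨hxR, hxB⟩ y ⟨hyR, hyB⟩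
  -- Points outside of `B` lie in the outer part of every cluster.
  have houter : ∀ {x}, x ∉ B → ∀ C ∈ P.parts, x ∈ outerPart X (C : Set V) := by
    intro x hx C hC
    have hfar := hB hx C hC
    by_contra hout
    obtain ⟨c, hc, hcx⟩ : ∃ c ∈ C, X.dist x c ≤ C.card * (2 * M) := by
      by_cases hxC : x ∈ C
      · exact ⟨x, hxC, by simp⟩
      · obtain ⟨c, hc, c', hc', h⟩ := exists_dist_add_dist_le hX (by simpa using hxC) hout
        have := hdiam C hC c hc c' hc'
        exact ⟨c, hc, by omega⟩
    have h1 := tri (u := s C) (v := c) (w := x)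
    have h2 := hdiam C hC _ (hs C hC) c hc
    rw [X.dist_comm (u := c)] at h1
    nlinarith
  -- A geodesic from the centre to a point outside of `B` does not meet a cluster whose
  -- thickening leaves the ball: past such a cluster only a short way to the boundary is left.
  let Q := P.parts.filter fun C : Finset V => thickening X (2 * M) (C : Set V) ⊆ natBall X o R
  let T : Set V := {z | z ∈ natBall X o R ∧ ∀ C ∈ P.parts, z ∈ C → C ∈ Q}
  have hgeod : ∀ {x}, x ∈ natBall X o R → x ∉ B → JoinedIn X T o x := by
    intro x hxR hxB
    refine (joinedIn_geodesic hX.connected o x).mono fun z hz => ?_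
    simp only [Set.mem_ofPred_eq, natBall] at hz hxR
    refine ⟨by simp only [natBall, Set.mem_ofPred_eq]; omega, fun C hC hzC => ?_⟩
    refine Finset.mem_filter.2 ⟨hC, ?_⟩
    rintro w ⟨c, hc, hcw⟩
    by_contra hw
    simp only [natBall, Set.mem_ofPred_eq] at hw
    have h1 := tri (u := o) (v := z) (w := w)
    have h2 := tri (u := z) (v := c) (w := w)
    have h3 := tri (u := s C) (v := z) (w := x)
    have h4 := hdiam C hC z hzC c hc
    have h5 := hdiam C hC _ (hs C hC) z hzC
    have h6 := hB hxB C hC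
    nlinarith
  have hjoin : JoinedIn X T x y := (hgeod hxR hxB).symm.trans (hgeod hyR hyB)
  -- Reroute the path around the clusters, one at a time.
  have hreroute : ∀ Q' ⊆ Q, JoinedIn X (T \ {z | ∃ C ∈ Q', z ∈ C}) x y := by
    intro Q'
    induction Q' using Finset.induction_on with
    | empty => exact fun _ => hjoin.mono fun z hz => ⟨hz, by simp⟩
    | insert C Q' hCQ' ih =>
      intro hsub
      have hCQ : C ∈ Q := hsub (Finset.mem_insert_self _ _)
      obtain ⟨hC, hCR⟩ := Finset.mem_filter.1 hCQ
      have h := (ih fun _ h => hsub (Finset.mem_insert_of_mem h)).detour (C := (C : Set V))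
        (houter hxB C hC) (houter hyB C hC) ?_
      · refine h.mono ?_
        rintro z ⟨⟨hzT, hz⟩, hzC⟩
        refine ⟨hzT, ?_⟩
        rintro ⟨C', hC', hzC'⟩
        obtain rfl | hC' := Finset.mem_insert.1 hC'
        · exact hzC hzC'
        · exact hz ⟨C', hC', hzC'⟩
      · rintro u hu v hv ⟨c, hc, huc⟩ ⟨c', hc', hvc⟩
        refine (joinedIn_thickening_diff hX.connected hM hsc (hchain C hC) hc hc' hu.1 hv.1 huc hvc
          (hend C u hu v hv)).mono ?_
        rintro z ⟨⟨a, ha, haz⟩, hzC⟩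
        -- Near `C` there are no points of other clusters.
        have hother : ∀ C' ∈ P.parts, z ∉ C' := by
          intro C' hC' hzC'
          have hne : C ≠ C' := by
            rintro rfl
            exact hzC hzC'
          exact absurd haz (not_le.2 (hsep C hC C' hC' hne a ha z hzC'))
        refine ⟨⟨⟨hCR ⟨a, ha, haz⟩, fun C' hC' h => absurd h (hother C' hC')⟩, ?_⟩, hzC⟩
        rintro ⟨C', hC', hzC'⟩
        exact hother C' (Finset.mem_filter.1 (hsub (Finset.mem_insert_of_mem hC'))).1 hzC'
  refine (hreroute Q subset_rfl).mono ?_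
  rintro z ⟨⟨hzR, hzQ⟩, hz⟩
  refine ⟨hzR, fun hzS => ?_⟩
  obtain ⟨C, hC, hzC⟩ := P.exists_mem (Finset.mem_coe.1 hzS)
  exact hz ⟨C, hzQ C hC hzC, hzC⟩

/-- Paths in `T` avoiding the image of `S` are paths in the induced subgraph on `T` avoiding `S`. -/
theorem JoinedIn.reachable_induce_induce {T : Set V} {S : Set T} {x y : V}
    (h : JoinedIn X (T \ Subtype.val '' S) x y) (hx : x ∈ T) (hxS : (⟨x, hx⟩ : T) ∈ Sᶜ) :
    ∃ (hy : y ∈ T) (hyS : (⟨y, hy⟩ : T) ∈ Sᶜ),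
      ((X.induce T).induce Sᶜ).Reachable ⟨⟨x, hx⟩, hxS⟩ ⟨⟨y, hy⟩, hyS⟩ := by
  induction h with
  | refl => exact ⟨hx, hxS, SimpleGraph.Reachable.refl _⟩
  | @tail z w _ h ih =>
    obtain ⟨hz, hzS, hr⟩ := ih
    have hwS : (⟨w, h.2.2.1⟩ : T) ∈ Sᶜ := fun hw => h.2.2.2 ⟨_, hw, rfl⟩
    refine ⟨h.2.2.1, hwS, hr.trans (SimpleGraph.Adj.reachable ?_)⟩
    exact h.1

end Separation

theorem exists_isCutSet_ncard_eq_cutSize {V : Type*} [Finite V] (Γ : SimpleGraph V) :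
    ∃ S, IsCutSet Γ S ∧ S.ncard = cutSize Γ :=
  Nat.sInf_mem (s := {n | ∃ S : Set V, IsCutSet Γ S ∧ S.ncard = n})
    ⟨_, Set.univ, isCutSet_univ Γ, rfl⟩

end CutBall

theorem proposition3p1 {α : Type*} [Finite α] [DecidableEq α]
    (rels : Set (FreeGroup α)) (hfin : rels.Finite)
    (M : ℕ) (hM : ∀ w ∈ rels, w.norm ≤ M)
    (hend : CutBall.IsOneEnded (CutBall.cayleyGraph rels))
    (r : ℝ) (hr : 0 ≤ r) :
    r / (400 * (M : ℝ)) ≤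
      (CutBall.cutSize ((CutBall.cayleyGraph rels).induce
        (CutBall.closedBall (CutBall.cayleyGraph rels) 1 r)) : ℝ) := by
  classical
  open CutBall in
  set X := cayleyGraph rels with hXdef
  rcases Nat.eq_zero_or_pos M with rfl | hMpos
  -- For `M = 0` (which one-endedness in fact excludes) the left-hand side is `r / 0 = 0`.
  · simp
  by_contra! hlt
  have hinf := hend.infinite
  have hX : IsHomogeneous X := isHomogeneous_cayleyGraph rels
  have hball : closedBall X 1 r = natBall X 1 ⌊r⌋₊ := by
    ext v
    simp only [closedBall, natBall, Set.mem_ofPred_eq, Nat.le_floor_iff hr]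
    exact and_iff_right (hX.connected 1 v)
  have hlf : X.LocallyFinite := fun v => Set.Finite.fintype <|
    (hX.finite_natBall v 1).subset fun w hw => (SimpleGraph.dist_eq_one_iff_adj.2 hw).le
  obtain ⟨S, hcut, hcard⟩ := exists_isCutSet_ncard_eq_cutSize (X.induce (closedBall X 1 r))
  have hS : (Subtype.val '' S).Finite := Set.toFinite _
  obtain ⟨B, hBfin, hBcard, hSB, hjoin⟩ := exists_small_joinedIn_diff hX hMpos
    (isCoarselySimplyConnected_cayleyGraph hM)
    (fun C x hx y hy => hend.joinedIn_compl hX.connected C hx.1 hy.1 hx.2 hy.2) 1 ⌊r⌋₊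
    hS.toFinset (by
      rw [← Set.ncard_eq_toFinset_card _ hS, Set.ncard_image_of_injective _ Subtype.val_injective,
        hcard]
      refine Nat.le_floor ?_
      rw [lt_div_iff₀ (by positivity)] at hlt
      push_cast
      have : (0 : ℝ) ≤ M * (cutSize (X.induce (closedBall X 1 r)) : ℝ) := by positivity
      linarith)
  rw [hS.coe_toFinset] at hSB hjoin
  rw [← hball] at hBcard hjoin
  have hfinball : (closedBall X 1 r).Finite := Set.toFinite _
  have hgood : (closedBall X 1 r).ncard ≤ (closedBall X 1 r \ B).ncard + B.ncard :=
    Set.ncard_le_ncard_sdiff_add_ncard _ _ hBfin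
  obtain ⟨x, hx⟩ : (closedBall X 1 r \ B).Nonempty := by
    rw [Set.nonempty_iff_ne_empty]
    intro h
    rw [h, Set.ncard_empty] at hgood
    omega
  have hxS : (⟨x, hx.1⟩ : closedBall X 1 r) ∈ Sᶜ := fun h => hx.2 (hSB ⟨_, h, rfl⟩)
  have hcomp := hcut (SimpleGraph.connectedComponentMk _ ⟨⟨x, hx.1⟩, hxS⟩)
  have hle : (closedBall X 1 r \ B).ncard ≤ (SimpleGraph.connectedComponentMk
      ((X.induce (closedBall X 1 r)).induce Sᶜ) ⟨⟨x, hx.1⟩, hxS⟩).supp.ncard := by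
    refine le_trans (Set.ncard_le_ncard ?_ (Set.toFinite _))
      (Set.ncard_image_le (f := fun v => (v.1.1 : PresentedGroup rels)) (Set.toFinite _))
    intro y hy
    obtain ⟨hyT, hyS, hreach⟩ := (hjoin x hx y hy).reachable_induce_induce hx.1 hxS
    exact ⟨⟨⟨y, hyT⟩, hyS⟩, SimpleGraph.ConnectedComponent.eq.2 hreach.symm, rfl⟩
  rw [Nat.card_coe_set_eq] at hcomp
  omega
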